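/- Notation. $\mathbb D$ is the open unit disc in $\mathbb C$, $\mathbb T=\partial\mathbb D$ carries Lebesgue (arc length) measure, a domain is a nonempty connected open set, $|\cdot|$ and $\mathrm{dist}$ are Euclidean, and $A\subset\subset D$ means that $A$ is contained in a compact subset of $D$. For a bounded holomorphic map $f:\mathbb D\to\mathbb C^n$ let $f^*(\zeta)=\lim_{r\to1^-}f(r\zeta)$, which exists for almost all $\zeta\in\mathbb T$; $f^*(\mathbb T)\subset\subset D$ means that for some compact $K\subset D$ one has $f^*(\zeta)\in K$ for almost all $\zeta\in\mathbb T$. Definitions. Let $m\ge2$ and let $D\subset\mathbb C^n$ be a domain. A holomorphic map $f:\mathbb D\to D$ is a weak $m$-extremal if there are pairwise distinct points $\lambda_1,\dots,\lambda_m\in\mathbb D$ such that no map $h$, holomorphic in a neighbourhood of $\overline{\mathbb D}$ with values in $D$, satisfies $h(\lambda_j)=f(\lambda_j)$ for $j=1,\dots,m$. If $D$ is bounded, a holomorphic map $f:\mathbb D\to D$ is almost proper if $f^*(\zeta)\in\partial D$ for almost all $\zeta\in\mathbb T$. The domain $D$ is weakly Runge if it is bounded and there is a domain $G\supset\overline D$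 such that every bounded holomorphic map $g:\mathbb D\to G$ with $g^*(\mathbb T)\subset\subset D$ satisfies $g(\mathbb D)\subset\subset D$. Proposition. Let $m\ge 2$. (1) Let $D\subset\mathbb C^n$ be a weakly Runge domain and let $f:\mathbb D\to D$ be a weak $m$-extremal such that for some $\gamma>0$ $$\mathrm{dist}(f(\lambda),\partial D)\ge\gamma(1-|\lambda|),\qquad \lambda\in\mathbb D.$$ Then for all real $\alpha>0$ and $\beta<1$ the set $$Q(\alpha,\beta)=\{\zeta\in\mathbb T:\ \mathrm{dist}(f(t\zeta),\partial D)\ge\alpha(1-t)^\beta\text{ for all }t\in(0,1)\}$$ has Lebesgue measure zero in $\mathbb T$. Moreover, $f$ is almost proper. (2) Every weak $m$-extremal of a bounded convex domain $D\subset\mathbb C^n$ is almost proper. -/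

import Mathlib

open MeasureTheory Set Filter Topology Metric

noncomputable section

namespace WeakExtremal

/-- The space `ℂⁿ` with the Euclidean norm. -/
abbrev Cn (n : ℕ) : Type := EuclideanSpace ℂ (Fin n)

/-- The open unit disc. -/
def disc : Set ℂ := ball 0 1

/-- A domain: a nonempty connected open set. -/
def IsDomainCn {n : ℕ} (D : Set (Cn n)) : Prop := IsOpen D ∧ IsConnected D

/-- `f` is a holomorphic map of the unit disc into `D`
(`f` is a total function, only its values on the disc matter). -/
def HolDisc {n : ℕ} (f : ℂ → Cn n) (D : Set (Cn n)) : Prop :=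
  DifferentiableOn ℂ f disc ∧ MapsTo f disc D

/-- `h` is holomorphic in a neighbourhood of the closed unit disc, with values in `D`. -/
def HolClosedDisc {n : ℕ} (h : ℂ → Cn n) (D : Set (Cn n)) : Prop :=
  ∃ U : Set ℂ, IsOpen U ∧ closedBall (0 : ℂ) 1 ⊆ U ∧ DifferentiableOn ℂ h U ∧ MapsTo h U D

/-- `f : 𝔻 → D` is a weak `m`-extremal for the points `l 0, …, l (m - 1)`. -/
def IsWeakExtremalFor {n m : ℕ} (D : Set (Cn n)) (f : ℂ → Cn n) (l : Fin m → ℂ) : Prop :=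
  HolDisc f D ∧ ¬ ∃ h : ℂ → Cn n, HolClosedDisc h D ∧ ∀ j, h (l j) = f (l j)

/-- `f : 𝔻 → D` is a weak `m`-extremal: it is one for some distinct points of the disc. -/
def IsWeakExtremal {n : ℕ} (m : ℕ) (D : Set (Cn n)) (f : ℂ → Cn n) : Prop :=
  ∃ l : Fin m → ℂ, Function.Injective l ∧ (∀ j, l j ∈ disc) ∧ IsWeakExtremalFor D f l

instance : MeasurableSpace Circle := borel Circle

instance : BorelSpace Circle := ⟨rfl⟩

/-- Lebesgue (arc length) measure on the unit circle. -/
def arcLength : Measure Circle :=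
  Measure.map Circle.exp (volume.restrict (Ioc 0 (2 * Real.pi)))

/-- The boundary value `f^*(ζ) = lim_{r → 1⁻} f (r ζ)` exists and equals `w`. -/
def HasBoundaryValue {n : ℕ} (f : ℂ → Cn n) (ζ : Circle) (w : Cn n) : Prop :=
  Tendsto (fun r : ℝ => f ((r : ℂ) * (ζ : ℂ))) (𝓝[<] 1) (𝓝 w)

/-- `f` is almost proper: `f^*(ζ)` (exists and) lies in `∂D` for almost all `ζ`. -/
def AlmostProper {n : ℕ} (D : Set (Cn n)) (f : ℂ → Cn n) : Prop :=
  ∀ᵐ ζ ∂arcLength, ∃ w ∈ frontier D, HasBoundaryValue f ζ w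

/-- `f^*(𝕋) ⊂⊂ D`: up to a null set, the boundary values lie in a compact subset of `D`. -/
def BoundaryValuesCompactlyIn {n : ℕ} (f : ℂ → Cn n) (D : Set (Cn n)) : Prop :=
  ∃ K : Set (Cn n), IsCompact K ∧ K ⊆ D ∧
    ∀ᵐ ζ ∂arcLength, ∃ w ∈ K, HasBoundaryValue f ζ w

/-- `f(𝔻) ⊂⊂ D`. -/
def ImageCompactlyIn {n : ℕ} (f : ℂ → Cn n) (D : Set (Cn n)) : Prop :=
  ∃ K : Set (Cn n), IsCompact K ∧ K ⊆ D ∧ MapsTo f disc K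

/-- Weakly Runge domains. -/
def WeaklyRunge {n : ℕ} (D : Set (Cn n)) : Prop :=
  IsDomainCn D ∧ Bornology.IsBounded D ∧
    ∃ G : Set (Cn n), IsDomainCn G ∧ closure D ⊆ G ∧
      ∀ f : ℂ → Cn n, HolDisc f G → Bornology.IsBounded (f '' disc) →
        BoundaryValuesCompactlyIn f D → ImageCompactlyIn f D

/-- The set `Q(α, β)` of all `ζ` in the unit circle with
`dist (f (t ζ), ∂D) ≥ α (1 - t) ^ β` for every `t ∈ (0, 1)`. -/
def Q {n : ℕ} (D : Set (Cn n)) (f : ℂ → Cn n) (α β : ℝ) : Set Circle :=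
  {ζ | ∀ t ∈ Ioo (0 : ℝ) 1, α * (1 - t) ^ β ≤ infDist (f ((t : ℂ) * (ζ : ℂ))) (frontier D)}

end WeakExtremal

end

/-! Suppose `Q D f α β` has positive measure. A competitor is built from `z ↦ f (r z)`, with `r`
close to 1. It misses the prescribed values by `O(1 - r)`, which is also the order of the guaranteed
distance to `∂D`, so plain Lagrange interpolation need not stay in `D`. The room of size `(1 - r) ^
β` over `Q` compensates: multiply the correction by `g = exp (L p)`, where `Re p ≤ 1` on the circle,
`Re p ≤ 0` off a neighbourhood of `Q`, and `Re p ≥ c > 0` at the nodes. Dividing by `g` at the nodes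
gains the factor `(1 - r) ^ ((1 - β) c) → 0`, while the growth of `g` is confined to where there is
room. This is `exists_holClosedDisc`; `exists_entire_peak` supplies `p`, with `c` independent of the
neighbourhood.

The circle then goes into `D`. Passing to the whole disc is the hypothesis `hR`, which follows from
the weak Runge property or, for convex `D`, from the maximum principle. Convexity also yields the
linear growth condition by a Hopf lemma.

Almost properness is the case `β = 0`: a radial limit inside `D` puts `ζ` in some `Q D f α 0`.
Existence of radial limits is Fatou's theorem, obtained by differentiating a Lipschitz primitive
along the circle. -/

namespace WeakExtremal

/-! ### Fatou's theorem via Lipschitz primitives -/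

/-- Maximum principle for bounded functions that may fail to be continuous at one boundary
point. -/
lemma norm_le_of_sphere_diff_singleton {k : ℂ → ℂ} {ζ : ℂ} {M S : ℝ} (hζ : ‖ζ‖ = 1)
    (hk : DifferentiableOn ℂ k (ball 0 1)) (hc : ContinuousOn k (closedBall 0 1 \ {ζ}))
    (hM : ∀ z ∈ closedBall (0 : ℂ) 1 \ {ζ}, ‖k z‖ ≤ M)
    (hS : ∀ z ∈ sphere (0 : ℂ) 1 \ {ζ}, ‖k z‖ ≤ S) {z : ℂ} (hz : z ∈ ball (0 : ℂ) 1) :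
    ‖k z‖ ≤ S := by
  have hζ0 : ζ ≠ 0 := by rintro rfl; simp at hζ
  have hS0 : 0 ≤ S := by
    refine (norm_nonneg _).trans (hS (-ζ) ⟨by simpa using hζ, ?_⟩)
    simpa [neg_eq_iff_add_eq_zero, ← two_mul] using hζ0
  have hzζ : z ≠ ζ := by rintro rfl; simp [hζ] at hz
  -- The factor `z - ζ` restores continuity at `ζ`; its cost, a factor 2, disappears on letting `N →
  -- ∞`.
  have key : ∀ N : ℕ, ‖k z‖ ^ N * ‖z - ζ‖ ≤ S ^ N * 2 := by
    intro N
    have hd : DiffContOnCl ℂ (fun z => k z ^ N * (z - ζ)) (ball 0 1) := by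
      refine ⟨(hk.pow N).mul (by fun_prop), ?_⟩
      rw [closure_ball _ one_ne_zero]
      intro w hw
      by_cases hwζ : w = ζ
      · subst hwζ
        have h0 : Tendsto (fun y : ℂ => max (M ^ N) 1 * ‖y - w‖) (𝓝[closedBall 0 1] w) (𝓝 0) := by
          have : Continuous (fun y : ℂ => max (M ^ N) 1 * ‖y - w‖) := by fun_prop
          simpa using this.continuousWithinAt.tendsto (s := closedBall 0 1) (x := w)
        have := squeeze_zero_norm' (f := fun y => k y ^ N * (y - w)) ?_ h0
        · simpa [ContinuousWithinAt] using this
        · filter_upwards [self_mem_nhdsWithin] with y hy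
          by_cases hyw : y = w
          · simp [hyw]
          · rw [norm_mul, norm_pow]
            gcongr
            exact (pow_le_pow_left₀ (norm_nonneg _) (hM y ⟨hy, hyw⟩) N).trans (le_max_left _ _)
      · have h1 : ContinuousWithinAt k (closedBall 0 1) w :=
          (hc w ⟨hw, hwζ⟩).mono_of_mem_nhdsWithin
            (inter_mem self_mem_nhdsWithin
              (mem_nhdsWithin_of_mem_nhds (isOpen_compl_singleton.mem_nhds hwζ)))
        exact (h1.pow N).mul (by fun_prop)
    have := Complex.norm_le_of_forall_mem_frontier_norm_le isBounded_ball hd (C := S ^ N * 2) ?_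
      (subset_closure hz)
    · simpa using this
    · intro w hw
      rw [frontier_ball _ one_ne_zero] at hw
      have hw1 : ‖w‖ = 1 := by simpa using hw
      by_cases hwζ : w = ζ
      · simp [hwζ]; positivity
      · rw [norm_mul, norm_pow]
        gcongr
        · exact hS w ⟨hw, hwζ⟩
        · linarith [norm_sub_le w ζ]
  by_contra! hlt
  have ha : 0 < ‖k z‖ := hS0.trans_lt hlt
  have hlim : Tendsto (fun N : ℕ => (S / ‖k z‖) ^ N * 2) atTop (𝓝 (0 * 2)) :=
    (tendsto_pow_atTop_nhds_zero_of_lt_one (by positivity) ((div_lt_one ha).2 hlt)).mul_const 2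
  have hpos : 0 < ‖z - ζ‖ := norm_pos_iff.2 (sub_ne_zero.2 hzζ)
  have : ‖z - ζ‖ ≤ 0 * 2 := by
    refine ge_of_tendsto' hlim fun N => ?_
    have := key N
    rw [div_pow, div_mul_eq_mul_div, le_div_iff₀ (by positivity)]
    linarith
  linarith

lemma re_mul_conj_sub_one {w ζ : ℂ} (hζ : ‖ζ‖ = 1) :
    (w * (starRingEnd ℂ) ζ - 1).re = (‖w‖ ^ 2 - 1 - ‖w - ζ‖ ^ 2) / 2 := by
  have h1 : ‖ζ‖ ^ 2 = 1 := by rw [hζ]; norm_num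
  rw [← Complex.normSq_eq_norm_sq, Complex.normSq_apply] at h1
  rw [← Complex.normSq_eq_norm_sq, ← Complex.normSq_eq_norm_sq, Complex.normSq_apply,
    Complex.normSq_apply]
  simp
  linarith

/-- If `Φ` is of order `o (w - ζ)` along the circle, it is so in the whole disc. -/
lemma isLittleO_of_sphere {Φ : ℂ → ℂ} {ζ : ℂ} {M : ℝ} (hζ : ‖ζ‖ = 1)
    (hd : DifferentiableOn ℂ Φ (ball 0 1)) (hc : Continuous Φ)
    (hM : ∀ z, ‖Φ z‖ ≤ M * ‖z - ζ‖)
    (hS : ∀ ε > 0, ∃ δ > 0, ∀ w : ℂ, ‖w‖ = 1 → ‖w - ζ‖ < δ → ‖Φ w‖ ≤ ε * ‖w - ζ‖)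
    {ε : ℝ} (hε : 0 < ε) :
    ∃ δ > 0, ∀ z ∈ ball (0 : ℂ) 1, ‖z - ζ‖ < δ → ‖Φ z‖ ≤ ε * ‖z - ζ‖ := by
  obtain ⟨δ, hδ, hδS⟩ := hS (ε / 2) (by positivity)
  have hM0 : 0 ≤ M := by
    have := (norm_nonneg _).trans (hM (ζ + 1))
    simpa using this
  obtain ⟨L, hL0, hL⟩ : ∃ L : ℝ, 0 ≤ L ∧ M * Real.exp (-(L * (δ ^ 2 / 2))) ≤ ε / 2 := by
    have h1 : Tendsto (fun L : ℝ => M * Real.exp (-(L * (δ ^ 2 / 2)))) atTop (𝓝 (M * 0)) :=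
      (Real.tendsto_exp_neg_atTop_nhds_zero.comp
        (tendsto_id.atTop_mul_const (by positivity))).const_mul M
    rw [mul_zero] at h1
    exact ((eventually_ge_atTop 0).and
      (h1.eventually_le_const (show (0 : ℝ) < ε / 2 by positivity))).exists
  -- On the circle the exponential has modulus `exp (-L ‖w - ζ‖² / 2)`: at most 1 near `ζ`, and
  -- small enough beyond distance `δ` to absorb `M`. It tends to 1 at `ζ`, so removing it there
  -- costs at most a factor 2.
  set k : ℂ → ℂ := fun z => Φ z / (z - ζ) * Complex.exp (L * (z * (starRingEnd ℂ) ζ - 1)) with hkdef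
  have hexp : ∀ z, ‖Complex.exp (L * (z * (starRingEnd ℂ) ζ - 1))‖
      = Real.exp (L * ((‖z‖ ^ 2 - 1 - ‖z - ζ‖ ^ 2) / 2)) := by
    intro z
    rw [Complex.norm_exp, Complex.re_ofReal_mul, re_mul_conj_sub_one hζ]
  have hdiv : ∀ z, z ≠ ζ → ‖Φ z / (z - ζ)‖ ≤ M := by
    intro z hz
    rw [norm_div, div_le_iff₀ (norm_pos_iff.2 (sub_ne_zero.2 hz))]
    exact hM z
  have hne : ∀ z ∈ ball (0 : ℂ) 1, z ≠ ζ := by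
    rintro z hz rfl
    simp [hζ] at hz
  have hk : ∀ z ∈ ball (0 : ℂ) 1, ‖k z‖ ≤ ε / 2 := by
    intro z hz
    refine norm_le_of_sphere_diff_singleton hζ (M := M) ?_ ?_ ?_ ?_ hz
    · refine (hd.div (by fun_prop) fun z hz => sub_ne_zero.2 (hne z hz)).mul ?_
      fun_prop
    · refine (hc.continuousOn.div (by fun_prop) fun z hz => sub_ne_zero.2 hz.2).mul ?_
      fun_prop
    · rintro z ⟨hz, hzζ⟩
      have hz1 : ‖z‖ ≤ 1 := by simpa using hz
      rw [hkdef, norm_mul, hexp, ← mul_one M]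
      gcongr
      · exact hdiv z hzζ
      · rw [Real.exp_le_one_iff]
        refine mul_nonpos_of_nonneg_of_nonpos hL0 ?_
        nlinarith [norm_nonneg z, sq_nonneg ‖z - ζ‖]
    · rintro w ⟨hw, hwζ⟩
      have hw1 : ‖w‖ = 1 := by simpa using hw
      have hpos : 0 < ‖w - ζ‖ := norm_pos_iff.2 (sub_ne_zero.2 hwζ)
      rw [hkdef, norm_mul, hexp, hw1]
      by_cases hwd : ‖w - ζ‖ < δ
      · rw [← mul_one (ε / 2)]
        gcongr
        · rw [norm_div, div_le_iff₀ hpos]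
          exact hδS w hw1 hwd
        · rw [Real.exp_le_one_iff]
          refine mul_nonpos_of_nonneg_of_nonpos hL0 ?_
          nlinarith [sq_nonneg ‖w - ζ‖]
      · refine le_trans ?_ hL
        gcongr
        · exact hdiv w hwζ
        · have : δ ^ 2 ≤ ‖w - ζ‖ ^ 2 := by gcongr; exact not_lt.1 hwd
          nlinarith
  have hcont : Tendsto (fun z : ℂ => ‖Complex.exp (L * (z * (starRingEnd ℂ) ζ - 1))‖) (𝓝 ζ)
      (𝓝 1) := by
    have hcc : Continuous (fun z : ℂ => ‖Complex.exp (L * (z * (starRingEnd ℂ) ζ - 1))‖) := by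
      fun_prop
    have := hcc.tendsto ζ
    simpa [Complex.mul_conj, Complex.normSq_eq_norm_sq, hζ] using this
  obtain ⟨δ', hδ', hE⟩ := Metric.eventually_nhds_iff.1
    (hcont.eventually_const_le (show (1 / 2 : ℝ) < 1 by norm_num))
  refine ⟨δ', hδ', fun z hz hzd => ?_⟩
  have h1 := hE (y := z) (by rwa [dist_eq_norm])
  have h2 := hk z hz
  have hpos : 0 < ‖z - ζ‖ := norm_pos_iff.2 (sub_ne_zero.2 (hne z hz))
  rw [hkdef, norm_mul, norm_div] at h2
  rw [← div_le_iff₀ hpos]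
  have h3 : 0 ≤ ‖Φ z‖ / ‖z - ζ‖ := by positivity
  nlinarith

/-- A statement that holds at `exp (i θ)` for almost every `θ` holds almost everywhere on the
circle. -/
lemma ae_arcLength {p : Circle → Prop} (h : ∀ᵐ θ : ℝ, p (Circle.exp θ)) :
    ∀ᵐ ζ ∂arcLength, p ζ := by
  obtain ⟨N, hN, hNm, hN0⟩ := exists_measurable_superset_of_null (ae_iff.1 h)
  -- A measurable inverse of `Circle.exp` with values in `(0, 2π]`; it turns a measurable null set
  -- of angles into a measurable null set on the circle.
  set a : Circle → ℝ := fun ζ =>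
    if 0 < Complex.arg ζ then Complex.arg ζ else Complex.arg ζ + 2 * Real.pi
  have harg : Measurable fun ζ : Circle => Complex.arg ζ :=
    Complex.measurable_arg.comp (by fun_prop : Continuous fun ζ : Circle => (ζ : ℂ)).measurable
  have ham : Measurable a :=
    Measurable.ite (measurableSet_lt measurable_const harg) harg (harg.add_const _)
  have ha : ∀ ζ, Circle.exp (a ζ) = ζ := by
    intro ζ
    simp only [a]
    split_ifs <;> simp
  have ha' : ∀ θ ∈ Ioc 0 (2 * Real.pi), a (Circle.exp θ) = θ := by
    rintro θ ⟨h0, h1⟩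
    simp only [a]
    by_cases hθ : θ ≤ Real.pi
    · rw [Circle.arg_exp (by linarith [Real.pi_pos]) hθ, if_pos h0]
    · have : Circle.exp θ = Circle.exp (θ - 2 * Real.pi) := by simp
      rw [this, Circle.arg_exp (by linarith [Real.pi_pos]) (by linarith [Real.pi_pos]),
        if_neg (by linarith)]
      ring
  rw [ae_iff]
  refine measure_mono_null (t := a ⁻¹' N) ?_ ?_
  · intro ζ hζ
    exact hN (by simpa [ha] using hζ)
  · rw [arcLength, Measure.map_apply Circle.exp.continuous.measurable (ham hNm),
      Measure.restrict_apply (Circle.exp.continuous.measurable (ham hNm))]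
    refine measure_mono_null ?_ hN0
    rintro θ ⟨h1, h2⟩
    simpa [ha' θ h2] using h1

/-- **Fatou's theorem** for bounded holomorphic functions on the disc. -/
theorem ae_exists_radial_limit {f : ℂ → ℂ} (hf : DifferentiableOn ℂ f (ball 0 1)) {C : ℝ}
    (hC : ∀ z ∈ ball (0 : ℂ) 1, ‖f z‖ ≤ C) :
    ∀ᵐ ζ : Circle ∂arcLength, ∃ w, Tendsto (fun r : ℝ => f ((r : ℂ) * (ζ : ℂ))) (𝓝[<] 1) (𝓝 w) := by
  obtain ⟨F₀, hF₀⟩ := hf.isExactOn_ball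
  have hC0 : 0 ≤ C := (norm_nonneg _).trans (hC 0 (by simp))
  have hlip : LipschitzOnWith ⟨C, hC0⟩ F₀ (ball 0 1) := by
    refine (convex_ball _ _).lipschitzOnWith_of_nnnorm_deriv_le
      (fun z hz => (hF₀ z hz).differentiableAt) fun z hz => ?_
    rw [(hF₀ z hz).deriv]
    exact hC z hz
  obtain ⟨F, hFlip, hFeq⟩ := hlip.extend_finite_dimension
  have hF : ∀ z ∈ ball (0 : ℂ) 1, HasDerivAt F (f z) z := fun z hz =>
    (hF₀ z hz).congr_of_eventuallyEq
      (hFeq.symm.eventuallyEq_of_mem (isOpen_ball.mem_nhds hz))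
  have hexpL : LipschitzWith 1 fun θ : ℝ => Complex.exp (θ * Complex.I) := by
    refine lipschitzWith_of_nnnorm_deriv_le (𝕜 := ℝ) (by fun_prop) fun θ => ?_
    have h1 : HasDerivAt (fun θ : ℝ => Complex.exp (θ * Complex.I))
        (Complex.exp (θ * Complex.I) * (1 * Complex.I)) θ :=
      ((Complex.ofRealCLM.hasDerivAt).mul_const Complex.I).cexp
    rw [h1.deriv, ← NNReal.coe_le_coe]
    simp
  refine ae_arcLength ?_
  filter_upwards [(hFlip.comp hexpL).ae_differentiableAt_real] with θ hθ
  set ζ : ℂ := Complex.exp (θ * Complex.I) with hζdef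
  have hζ1 : ‖ζ‖ = 1 := Complex.norm_exp_ofReal_mul_I θ
  have hζ0 : ζ ≠ 0 := Complex.exp_ne_zero _
  obtain ⟨B, hB⟩ : ∃ B, HasDerivAt (F ∘ fun θ : ℝ => Complex.exp (θ * Complex.I)) B θ :=
    ⟨_, hθ.hasDerivAt⟩
  -- By the chain rule this is the derivative of `F` at `ζ` along the circle, and it will be the
  -- radial limit of `f = F'`.
  set A : ℂ := B / (ζ * Complex.I)
  set Φ : ℂ → ℂ := fun z => F z - F ζ - A * (z - ζ) with hΦ
  have hd : ∀ z ∈ ball (0 : ℂ) 1, HasDerivAt Φ (f z - A) z := fun z hz => by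
    have := ((hF z hz).sub_const (F ζ)).sub (((hasDerivAt_id z).sub_const ζ).const_mul A)
    rw [mul_one] at this
    exact this
  have hsphere : ∀ ε > 0, ∃ δ > 0, ∀ w : ℂ, ‖w‖ = 1 → ‖w - ζ‖ < δ → ‖Φ w‖ ≤ ε * ‖w - ζ‖ := by
    intro ε hε
    have he : HasDerivAt (fun t : ℝ => Complex.exp (t * Complex.I)) (ζ * Complex.I) θ := by
      simpa using ((Complex.ofRealCLM.hasDerivAt (x := θ)).mul_const Complex.I).cexp
    have hΦd : HasDerivAt (fun t : ℝ => Φ (Complex.exp (t * Complex.I))) 0 θ := by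
      have := (hB.sub_const (F ζ)).sub ((he.sub_const ζ).const_mul A)
      have h0 : B - A * (ζ * Complex.I) = 0 := by
        simp only [A]; field_simp; simp
      rw [h0] at this
      exact this
    have hlo : (fun t : ℝ => Φ (Complex.exp (t * Complex.I))) =o[𝓝 θ] fun t => t - θ := by
      simpa [hΦ, ← hζdef] using hΦd.isLittleO
    have hO : (fun t : ℝ => t - θ) =O[𝓝 θ] fun t => Complex.exp (t * Complex.I) - ζ := by
      exact (he.isTheta_sub (by simp [hζ0])).isBigO_symm.comp_tendsto
        (k := fun t : ℝ => (t, θ)) (tendsto_id.prodMk (tendsto_pure.2 (Eventually.of_forall fun _ => rfl)))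
    have h1 := (hlo.trans_isBigO hO).bound hε
    have harg : Tendsto (fun w : ℂ => θ + Complex.arg (w / ζ)) (𝓝 ζ) (𝓝 θ) := by
      have h2 : Tendsto (fun w : ℂ => w / ζ) (𝓝 ζ) (𝓝 1) := by
        have : Continuous fun w : ℂ => w / ζ := by fun_prop
        simpa [hζ0] using this.tendsto ζ
      have h3 := (Complex.continuousAt_arg (x := 1) (by simp)).tendsto.comp h2
      simpa using h3.const_add θ
    obtain ⟨δ, hδ, H⟩ := Metric.eventually_nhds_iff.1 (harg.eventually h1)
    refine ⟨δ, hδ, fun w hw hwδ => ?_⟩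
    have h4 := H (y := w) (by rwa [dist_eq_norm])
    have h5 : Complex.exp ((θ + Complex.arg (w / ζ) : ℝ) * Complex.I) = w := by
      have h6 := Complex.norm_mul_exp_arg_mul_I (w / ζ)
      rw [norm_div, hw, hζ1] at h6
      push_cast
      rw [add_mul, Complex.exp_add, ← hζdef]
      have h7 : Complex.exp (Complex.arg (w / ζ) * Complex.I) = w / ζ := by simpa using h6
      rw [h7]
      field_simp
    rwa [h5] at h4
  have hΦc : Continuous Φ := by
    have := hFlip.continuous
    fun_prop
  have hΦM : ∀ z, ‖Φ z‖ ≤ ((lipschitzExtensionConstant ℂ * ⟨C, hC0⟩ : NNReal) + ‖A‖) * ‖z - ζ‖ := by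
    intro z
    rw [add_mul]
    refine (norm_sub_le _ _).trans (add_le_add ?_ (norm_mul_le _ _))
    simpa [dist_eq_norm] using hFlip.dist_le_mul z ζ
  refine ⟨A, ?_⟩
  rw [Metric.tendsto_nhds]
  intro ε hε
  obtain ⟨δ, hδ, H⟩ := isLittleO_of_sphere hζ1
    (fun z hz => (hd z hz).differentiableAt.differentiableWithinAt) hΦc hΦM hsphere
    (show 0 < ε / 4 by positivity)
  have hev : ∀ᶠ r : ℝ in 𝓝[<] 1, r ∈ Ioo (max 0 (1 - δ / 2)) 1 :=
    Ioo_mem_nhdsLT (max_lt one_pos (by linarith))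
  filter_upwards [hev] with r ⟨hr, hr1⟩
  have hr0 : 0 < r := (le_max_left _ _).trans_lt hr
  have hrδ : 1 - δ / 2 < r := (le_max_right _ _).trans_lt hr
  have hcoe : ((Circle.exp θ : Circle) : ℂ) = ζ := by rw [Circle.coe_exp]
  rw [hcoe, dist_eq_norm]
  have hnr : ‖(r : ℂ) * ζ‖ = r := by simp [hζ1, abs_of_pos hr0]
  have hrζ : ‖(r : ℂ) * ζ - ζ‖ = 1 - r := by
    rw [show (r : ℂ) * ζ - ζ = ((r - 1 : ℝ) : ℂ) * ζ by push_cast; ring, norm_mul, hζ1, mul_one,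
      Complex.norm_real, Real.norm_eq_abs, abs_of_neg (by linarith)]
    ring
  have hsub : closedBall ((r : ℂ) * ζ) ((1 - r) / 2) ⊆ ball 0 1 := by
    intro z hz
    have h1 : ‖z - r * ζ‖ ≤ (1 - r) / 2 := by simpa [dist_eq_norm] using hz
    have h2 : ‖z‖ ≤ ‖z - r * ζ‖ + ‖r * ζ‖ := by simpa using norm_add_le (z - r * ζ) (r * ζ)
    rw [mem_ball_zero_iff]
    linarith
  have hcen : (r : ℂ) * ζ ∈ ball (0 : ℂ) 1 := hsub (mem_closedBall_self (by linarith))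
  -- The points of this circle lie within `3 (1 - r) / 2` of `ζ`, so Cauchy's estimate gives `‖f (r
  -- ζ) - A‖ ≤ 3 ε / 4`.
  have hcauchy := Complex.norm_deriv_le_of_forall_mem_sphere_norm_le (f := Φ)
    (c := (r : ℂ) * ζ) (R := (1 - r) / 2) (C := ε / 4 * (3 * ((1 - r) / 2))) (by linarith) ?_ ?_
  · rw [(hd _ hcen).deriv, ← mul_assoc, mul_div_assoc, div_self (by linarith)] at hcauchy
    linarith
  · refine ⟨fun z hz => (hd z (hsub (ball_subset_closedBall hz))).differentiableAt.differentiableWithinAt,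
      hΦc.continuousOn⟩
  · intro z hz
    have h1 : ‖z - r * ζ‖ = (1 - r) / 2 := by simpa [dist_eq_norm] using hz
    have h2 : ‖z - ζ‖ ≤ 3 * ((1 - r) / 2) := by
      have := norm_add_le (z - r * ζ) (r * ζ - ζ)
      rw [sub_add_sub_cancel] at this
      linarith
    refine (H z (hsub (sphere_subset_closedBall hz)) (by linarith)).trans ?_
    gcongr

/-! ### Harnack's inequality and peak functions -/

/-- Harnack's inequality for the real part of a holomorphic function. -/
lemma harnack_re {k : ℂ → ℂ} (hk : DifferentiableOn ℂ k (ball 0 1))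
    (hpos : ∀ z ∈ ball (0 : ℂ) 1, 0 < (k z).re) {z : ℂ} (hz : z ∈ ball (0 : ℂ) 1) :
    (1 - ‖z‖) / 2 * (k 0).re ≤ (k z).re := by
  have hz1 : ‖z‖ < 1 := by simpa using hz
  have h0 : 0 < (k 0).re := hpos 0 (by simp)
  set c : ℂ := (starRingEnd ℂ) (k 0)
  have hne : ∀ w ∈ ball (0 : ℂ) 1, k w + c ≠ 0 := by
    intro w hw h
    have := congrArg Complex.re h
    simp [c] at this
    linarith [hpos w hw]
  have hnorm : ∀ w, ‖k w - k 0‖ ^ 2 = ((k w).re - (k 0).re) ^ 2 + ((k w).im - (k 0).im) ^ 2 := by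
    intro w
    rw [← Complex.normSq_eq_norm_sq, Complex.normSq_apply]
    simp; ring
  have hnorm' : ∀ w, ‖k w + c‖ ^ 2 = ((k w).re + (k 0).re) ^ 2 + ((k w).im - (k 0).im) ^ 2 := by
    intro w
    rw [← Complex.normSq_eq_norm_sq, Complex.normSq_apply]
    simp [c]; ring
  -- Schwarz lemma for the Cayley transform sending the right half-plane to the disc and `k 0` to 0.
  have hs := Complex.norm_le_norm_of_mapsTo_ball (f := fun w => (k w - k 0) / (k w + c)) (R := 1)
    (z := z) ((hk.sub_const _).div (hk.add_const _) hne) ?_ (by simp) hz1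
  · rw [norm_div, div_le_iff₀ (norm_pos_iff.2 (hne z hz))] at hs
    have h2 : ‖k z - k 0‖ ^ 2 ≤ (‖z‖ * ‖k z + c‖) ^ 2 := by gcongr
    rw [mul_pow, hnorm, hnorm'] at h2
    have hu := hpos z hz
    have hz0 := norm_nonneg z
    have h3 : ((k z).re - (k 0).re) ^ 2 ≤ (‖z‖ * ((k z).re + (k 0).re)) ^ 2 := by
      have : ‖z‖ ^ 2 ≤ 1 := by nlinarith
      nlinarith [sq_nonneg ((k z).im - (k 0).im)]
    have h4 := (abs_le.1 (abs_le_of_sq_le_sq h3 (by positivity))).1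
    nlinarith
  · intro w hw
    rw [mem_closedBall_zero_iff, norm_div, div_le_one (norm_pos_iff.2 (hne w hw))]
    refine (pow_le_pow_iff_left₀ (norm_nonneg _) (norm_nonneg _) two_ne_zero).1 ?_
    rw [hnorm, hnorm']
    nlinarith [hpos w hw]

/-- Maximum principle for the real part of a holomorphic function. -/
lemma re_le_of_sphere {h : ℂ → ℂ} (hd : DiffContOnCl ℂ h (ball 0 1)) {C : ℝ}
    (hC : ∀ z : ℂ, ‖z‖ = 1 → (h z).re ≤ C) {z : ℂ} (hz : ‖z‖ ≤ 1) : (h z).re ≤ C := by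
  have := Complex.norm_le_of_forall_mem_frontier_norm_le (f := fun z => Complex.exp (h z))
    (U := ball 0 1) (C := Real.exp C) (z := z) isBounded_ball
    (Complex.differentiable_exp.comp_diffContOnCl hd) ?_ ?_
  · simpa [Complex.norm_exp] using this
  · intro w hw
    rw [frontier_ball _ one_ne_zero] at hw
    simpa [Complex.norm_exp] using hC w (by simpa using hw)
  · rw [closure_ball _ one_ne_zero]
    simpa using hz

/-- Real parts of entire functions are uniformly dense in the real continuous functions on the
circle. -/
lemma exists_entire_re_near (φ : C(Circle, ℝ)) {ε : ℝ} (hε : 0 < ε) :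
    ∃ p : ℂ → ℂ, Differentiable ℂ p ∧ ∀ ζ : Circle, |(p ζ).re - φ ζ| < ε := by
  have : Fact (0 < 2 * Real.pi) := ⟨by positivity⟩
  let e := AddCircle.homeomorphCircle'
  let ψ : C(AddCircle (2 * Real.pi), ℂ) :=
    ⟨fun x => ((φ (e x) : ℝ) : ℂ), by fun_prop⟩
  have hψ : ψ ∈ (Submodule.span ℂ (range <| @fourier (2 * Real.pi))).topologicalClosure := by
    rw [span_fourier_closure_eq_top]; trivial
  obtain ⟨q, hq, hqd⟩ := Metric.mem_closure_iff.1 hψ ε hε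
  have hfour : ∀ (n : ℤ) (x : AddCircle (2 * Real.pi)), fourier n x = ((e x : Circle) : ℂ) ^ n := by
    intro n x
    rw [fourier_apply, AddCircle.toCircle_zsmul]
    have : AddCircle.toCircle x = e x := by
      induction x using QuotientAddGroup.induction_on with
      | H x =>
        rw [AddCircle.toCircle_apply_mk, AddCircle.homeomorphCircle'_apply_mk]
        congr 1
        field_simp
    rw [this]; simp
  -- Negative frequencies are conjugates of positive ones on the circle, and conjugation does not
  -- change the real part, so `p₁ + p₂` will do.
  have hspan : ∃ p₁ p₂ : ℂ → ℂ, Differentiable ℂ p₁ ∧ Differentiable ℂ p₂ ∧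
      ∀ x, q x = p₁ (e x) + (starRingEnd ℂ) (p₂ (e x)) := by
    clear hqd
    induction hq using Submodule.span_induction with
    | mem q hq =>
      obtain ⟨n, rfl⟩ := hq
      obtain ⟨n, rfl | rfl⟩ := n.eq_nat_or_neg
      · exact ⟨fun z => z ^ n, 0, by fun_prop, by fun_prop, fun x => by simp [hfour]⟩
      · refine ⟨0, fun z => z ^ n, by fun_prop, by fun_prop, fun x => ?_⟩
        rw [hfour]
        simp [← Circle.coe_inv_eq_conj]
    | zero => exact ⟨0, 0, by fun_prop, by fun_prop, fun x => by simp⟩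
    | add q q' _ _ h h' =>
      obtain ⟨p₁, p₂, h₁, h₂, h⟩ := h
      obtain ⟨p₁', p₂', h₁', h₂', h'⟩ := h'
      exact ⟨p₁ + p₁', p₂ + p₂', h₁.add h₁', h₂.add h₂', fun x => by simp [h, h']; ring⟩
    | smul a q _ h =>
      obtain ⟨p₁, p₂, h₁, h₂, h⟩ := h
      exact ⟨fun z => a * p₁ z, fun z => (starRingEnd ℂ) a * p₂ z, h₁.const_mul _, h₂.const_mul _,
        fun x => by simp [h]; ring⟩
  obtain ⟨p₁, p₂, h₁, h₂, h⟩ := hspan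
  refine ⟨fun z => p₁ z + p₂ z, h₁.add h₂, fun ζ => ?_⟩
  have h3 := (ContinuousMap.dist_apply_le_dist (e.symm ζ)).trans_lt hqd
  rw [dist_comm, dist_eq_norm] at h3
  refine lt_of_le_of_lt ?_ ((Complex.abs_re_le_norm _).trans_lt h3)
  apply le_of_eq
  simp [h, ψ]

/-- The mean value property bounds `Re k 0` from below by the measure of a set of boundary points
where `Re k` is at least one. -/
lemma arcLength_le_two_pi_mul_re {k : ℂ → ℂ} (hk : Differentiable ℂ k) {Q : Set Circle}
    (hQ : IsClosed Q) (h0 : ∀ ζ : Circle, 0 ≤ (k ζ).re) (h1 : ∀ ζ ∈ Q, 1 ≤ (k ζ).re) :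
    (arcLength Q).toReal ≤ 2 * Real.pi * (k 0).re := by
  have hmean : Real.circleAverage k 0 1 = k 0 := hk.diffContOnCl.circleAverage
  have hkc := hk.continuous
  have hcm : ∀ θ : ℝ, circleMap 0 1 θ = (Circle.exp θ : ℂ) := fun θ => by simp [circleMap]
  have hint : (k 0).re = (2 * Real.pi)⁻¹ * ∫ θ in Ioc 0 (2 * Real.pi), (k (Circle.exp θ)).re := by
    rw [← hmean, Real.circleAverage_def, Complex.smul_re, smul_eq_mul,
      intervalIntegral.integral_of_le (by positivity)]
    congr 1
    simp only [hcm]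
    have hi : Integrable (fun θ : ℝ => k (Circle.exp θ)) (volume.restrict (Ioc 0 (2 * Real.pi))) :=
      ((by fun_prop : Continuous fun θ : ℝ => k (Circle.exp θ)).integrableOn_Ioc)
    exact (integral_re hi).symm
  have hQm : MeasurableSet (Circle.exp ⁻¹' Q : Set ℝ) :=
    (hQ.preimage Circle.exp.continuous).measurableSet
  have hle : (arcLength Q).toReal ≤ ∫ θ in Ioc 0 (2 * Real.pi), (k (Circle.exp θ)).re := by
    have hm : (arcLength Q).toReal
        = ∫ θ in Ioc 0 (2 * Real.pi), (Circle.exp ⁻¹' Q : Set ℝ).indicator 1 θ := by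
      rw [integral_indicator_one hQm, arcLength,
        Measure.map_apply Circle.exp.continuous.measurable hQ.measurableSet]
      rfl
    rw [hm]
    refine integral_mono ((integrable_const (1 : ℝ)).indicator hQm)
      ((by fun_prop : Continuous fun θ : ℝ => (k (Circle.exp θ)).re).integrableOn_Ioc) fun θ => ?_
    by_cases hθ : θ ∈ (Circle.exp ⁻¹' Q : Set ℝ)
    · simpa [hθ] using h1 _ hθ
    · simpa [hθ] using h0 (Circle.exp θ)
  rw [hint, mul_inv_cancel_left₀ (by positivity)]
  exact hle

/-- Entire functions whose real part is at most one on the circle, nonpositive off a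
neighbourhood of `Q`, and bounded below by a positive constant at given points of the disc. -/
lemma exists_entire_peak {ι : Type*} [Finite ι] {Q : Set Circle} (hQ : IsClosed Q)
    (hpos : arcLength Q ≠ 0) {l : ι → ℂ} (hl : ∀ j, l j ∈ ball (0 : ℂ) 1) :
    ∃ c > 0, ∀ U : Set Circle, IsOpen U → Q ⊆ U → ∃ p : ℂ → ℂ, Differentiable ℂ p ∧
      (∀ ζ : Circle, (p ζ).re ≤ 1) ∧ (∀ ζ : Circle, ζ ∉ U → (p ζ).re ≤ 0) ∧
      ∀ j, c ≤ (p (l j)).re := by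
  have : IsFiniteMeasure arcLength := by unfold arcLength; infer_instance
  set a : ℝ := (arcLength Q).toReal / (2 * Real.pi) with ha
  have ha0 : 0 < a := div_pos (ENNReal.toReal_pos hpos (measure_ne_top _ _)) (by positivity)
  obtain ⟨s, hs, hs0⟩ : ∃ s : ℝ, (∀ j, s < (1 - ‖l j‖) / 2) ∧ 0 < s := by
    have h1 : ∀ᶠ s : ℝ in 𝓝[>] 0, ∀ j, s < (1 - ‖l j‖) / 2 := by
      refine eventually_all.2 fun j => ?_
      have := hl j
      rw [mem_ball_zero_iff] at this
      exact mem_nhdsWithin_of_mem_nhds (Iio_mem_nhds (by linarith))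
    exact (h1.and self_mem_nhdsWithin).exists
  -- Harnack gives `Re (p + 2η) ≥ s a = 4η` at the nodes, hence `Re (p - η) ≥ η`. Neither `s` nor
  -- `a` depends on `U`.
  set η := s * a / 4 with hη
  have hη0 : 0 < η := by positivity
  refine ⟨η, hη0, fun U hU hQU => ?_⟩
  obtain ⟨φ, hφ0, hφ1, hφ⟩ := exists_continuous_zero_one_of_isClosed hU.isClosed_compl hQ
    (disjoint_compl_left_iff_subset.2 hQU)
  obtain ⟨p, hp, hpφ⟩ := exists_entire_re_near φ hη0
  refine ⟨fun z => p z - η, hp.sub_const _, fun ζ => ?_, fun ζ hζ => ?_, fun j => ?_⟩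
  · have := (abs_lt.1 (hpφ ζ)).2
    have := (hφ ζ).2
    simp; linarith
  · have := (abs_lt.1 (hpφ ζ)).2
    have : φ ζ = 0 := hφ0 hζ
    simp; linarith
  · set k : ℂ → ℂ := fun z => p z + (2 * η : ℝ) with hk
    have hkd : Differentiable ℂ k := hp.add_const _
    have hkre : ∀ z, (k z).re = (p z).re + 2 * η := fun z => by simp [hk]
    have hkφ : ∀ ζ : Circle, φ ζ + η ≤ (k ζ).re := fun ζ => by
      rw [hkre]
      linarith [(abs_lt.1 (hpφ ζ)).1]
    have hkpos : ∀ z ∈ ball (0 : ℂ) 1, 0 < (k z).re := by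
      intro z hz
      have := re_le_of_sphere (h := fun z => -k z) (C := -η) hkd.neg.diffContOnCl (fun w hw => ?_)
        (z := z) (by simpa using (mem_ball_zero_iff.1 hz).le)
      · simp only [Complex.neg_re] at this
        linarith
      · have h1 := hkφ ⟨w, by simpa [Submonoid.unitSphere] using hw⟩
        have h2 := (hφ ⟨w, by simpa [Submonoid.unitSphere] using hw⟩).1
        simp only [Complex.neg_re]
        linarith
    have hk0 : a ≤ (k 0).re := by
      rw [ha, div_le_iff₀' (by positivity)]
      refine arcLength_le_two_pi_mul_re hkd hQ (fun ζ => ?_) fun ζ hζ => ?_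
      · linarith [hkφ ζ, (hφ ζ).1]
      · have : φ ζ = 1 := hφ1 hζ
        linarith [hkφ ζ]
    have h1 := harnack_re hkd.differentiableOn hkpos (hl j)
    have h2 : s * a ≤ (1 - ‖l j‖) / 2 * (k 0).re :=
      mul_le_mul (hs j).le hk0 ha0.le (hs0.le.trans (hs j).le)
    have h3 := hkre (l j)
    simp only [Complex.sub_re, Complex.ofReal_re]
    linarith

/-! ### Distance to the boundary and the sets `Q` -/

/-- The ball around `x` of radius `infDist x (frontier D)` is connected and misses the frontier, so
it cannot leave the interior. -/
lemma mem_of_norm_sub_lt_infDist_frontier {E : Type*} [NormedAddCommGroup E] [NormedSpace ℝ E]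
    {D : Set E} {x y : E} (hx : x ∈ D) (hxy : ‖y - x‖ < infDist x (frontier D)) : y ∈ D := by
  set s := infDist x (frontier D)
  have hs : 0 < s := (norm_nonneg _).trans_lt hxy
  have hdisj : ∀ w ∈ ball x s, w ∉ frontier D := fun w hw hwD =>
    (infDist_le_dist_of_mem hwD).not_gt (by rwa [dist_comm])
  have hsub : ball x s ⊆ interior D := by
    refine (convex_ball x s).isPreconnected.subset_left_of_subset_union isOpen_interior
      (isClosed_closure (s := D)).isOpen_compl ?_ ?_ ⟨x, mem_ball_self hs, ?_⟩
    · exact disjoint_compl_right_iff_subset.2 (interior_subset.trans subset_closure)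
    · intro w hw
      by_contra! h
      exact hdisj w hw ⟨by_contra fun h' => h (Or.inr h'), fun h' => h (Or.inl h')⟩
    · by_contra h
      exact hdisj x (mem_ball_self hs) ⟨subset_closure hx, h⟩
  exact interior_subset (hsub (by rwa [mem_ball, dist_eq_norm]))

lemma isClosed_Q {n : ℕ} {D : Set (Cn n)} {f : ℂ → Cn n} (hf : DifferentiableOn ℂ f disc)
    (α β : ℝ) : IsClosed (Q D f α β) := by
  have : Q D f α β = ⋂ t ∈ Ioo (0 : ℝ) 1, {ζ : Circle |
      α * (1 - t) ^ β ≤ infDist (f ((t : ℂ) * (ζ : ℂ))) (frontier D)} := by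
    ext ζ; simp [Q]
  rw [this]
  refine isClosed_biInter fun t ht => isClosed_le continuous_const ?_
  refine (continuous_infDist_pt _).comp (hf.continuousOn.comp_continuous (by fun_prop) fun ζ => ?_)
  simp [disc, Circle.norm_coe, abs_of_pos ht.1, ht.2]

lemma Q_subset_Q {n : ℕ} {D : Set (Cn n)} {f : ℂ → Cn n} {α β β' : ℝ} (hα : 0 ≤ α)
    (h : β ≤ β') : Q D f α β ⊆ Q D f α β' := by
  intro ζ hζ t ht
  refine le_trans ?_ (hζ t ht)
  gcongr ?_ * ?_
  exact Real.rpow_le_rpow_of_exponent_ge (by linarith [ht.2]) (by linarith [ht.1]) h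

/-! ### Correcting a dilation of the extremal -/

/-- Lagrange interpolation functions at finitely many points, bounded on the closed disc. -/
lemma exists_lagrange {m : ℕ} {l : Fin m → ℂ} (hl : Function.Injective l) :
    ∃ q : Fin m → ℂ → ℂ, (∀ j, Differentiable ℂ (q j)) ∧ (∀ i j, q j (l i) = if i = j then 1 else 0) ∧
      ∃ B ≥ 0, ∀ z : ℂ, ‖z‖ ≤ 1 → ∑ j, ‖q j z‖ ≤ B := by
  refine ⟨fun j z => (Lagrange.basis Finset.univ l j).eval z, fun j => Polynomial.differentiable _,
    fun i j => ?_, ?_⟩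
  · by_cases h : i = j
    · subst h
      simpa using Lagrange.eval_basis_self hl.injOn (Finset.mem_univ i)
    · simpa [h] using Lagrange.eval_basis_of_ne (Ne.symm h) (Finset.mem_univ i)
  · obtain ⟨B, hB⟩ := (isCompact_closedBall (0 : ℂ) 1).exists_bound_of_continuousOn
      (f := fun z => ∑ j, ‖(Lagrange.basis Finset.univ l j).eval z‖)
      (continuous_finsetSum _ fun j _ => (Polynomial.continuous _).norm).continuousOn
    refine ⟨max B 0, le_max_right _ _, fun z hz => ?_⟩
    exact (le_abs_self _).trans ((hB z (by simpa using hz)).trans (le_max_left _ _))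

lemma eventually_norm_sub_dilation_le {n m : ℕ} {f : ℂ → Cn n} (hf : DifferentiableOn ℂ f disc)
    {l : Fin m → ℂ} (hl : ∀ j, l j ∈ disc) :
    ∃ V ≥ 0, ∀ᶠ r : ℝ in 𝓝[<] 1, ∀ j, ‖f (l j) - f (r * l j)‖ ≤ V * (1 - r) := by
  have h1 : ∀ j, ∃ V, ∀ᶠ r : ℝ in 𝓝[<] 1, ‖f (l j) - f (r * l j)‖ ≤ V * (1 - r) := by
    intro j
    have hd : DifferentiableAt ℝ (fun r : ℝ => f (r * l j)) 1 := by
      have h2 : DifferentiableAt ℂ f (((1 : ℝ) : ℂ) * l j) := by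
        simpa using hf.differentiableAt (isOpen_ball.mem_nhds (hl j))
      exact (h2.restrictScalars ℝ).comp (1 : ℝ) (by fun_prop)
    obtain ⟨V, hV⟩ := hd.isBigO_sub.bound
    refine ⟨V, ?_⟩
    filter_upwards [mem_nhdsWithin_of_mem_nhds hV, self_mem_nhdsWithin] with r hr hr1
    have hr1 : r < 1 := hr1
    rw [norm_sub_rev]
    simpa [abs_of_neg (sub_neg.2 hr1)] using hr
  choose V hV using h1
  refine ⟨∑ j, |V j|, by positivity, ?_⟩
  filter_upwards [eventually_all.2 hV, self_mem_nhdsWithin] with r hr hr1 j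
  have hr1 : r < 1 := hr1
  refine (hr j).trans (mul_le_mul_of_nonneg_right ?_ (by linarith))
  exact (le_abs_self _).trans
    (Finset.single_le_sum (f := fun j => |V j|) (fun j _ => abs_nonneg _) (Finset.mem_univ j))

/-- If `Q D f α β` has positive measure, a small correction of a dilation of `f` is holomorphic
near the closed disc and takes the values of `f` at the given points. -/
theorem exists_holClosedDisc {n m : ℕ} {D : Set (Cn n)} {f : ℂ → Cn n} {l : Fin m → ℂ}
    (hDo : IsOpen D) (hf : HolDisc f D) (hlinj : Function.Injective l) (hl : ∀ j, l j ∈ disc)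
    {γ α β ρ : ℝ} (hγ : 0 < γ)
    (hγf : ∀ z ∈ disc, γ * (1 - ‖z‖) ≤ infDist (f z) (frontier D))
    (hα : 0 < α) (hβ0 : 0 < β) (hβ1 : β < 1) (hρ : 0 < ρ)
    (hR : ∀ (h : ℂ → Cn n) (V : Set ℂ), IsOpen V → closedBall 0 1 ⊆ V → DifferentiableOn ℂ h V →
      (∀ z ∈ closedBall (0 : ℂ) 1, ∃ x ∈ D, ‖h z - x‖ ≤ ρ) → (∀ z ∈ sphere (0 : ℂ) 1, h z ∈ D) →
      ∀ z ∈ closedBall (0 : ℂ) 1, h z ∈ D)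
    (hQ : arcLength (Q D f α β) ≠ 0) :
    ∃ h, HolClosedDisc h D ∧ ∀ j, h (l j) = f (l j) := by
  obtain ⟨c, hc, hpeak⟩ := exists_entire_peak (isClosed_Q hf.1 α β) hQ hl
  obtain ⟨q, hqd, hq, B, hB0, hB⟩ := exists_lagrange hlinj
  obtain ⟨V, hV0, hV⟩ := eventually_norm_sub_dilation_le hf.1 hl
  -- The relative size of the correction: `B` bounds the interpolation functions, `V` the error at
  -- the nodes, and the power is the gain from dividing by `g (l j)`.
  have hδlim : Tendsto (fun r : ℝ => B * V * (1 - r) ^ ((1 - β) * c)) (𝓝[<] 1) (𝓝 0) := by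
    have h1 : ContinuousAt (fun r : ℝ => B * V * (1 - r) ^ ((1 - β) * c)) 1 := by
      refine continuousAt_const.mul (ContinuousAt.rpow_const (by fun_prop) (Or.inr ?_))
      have : 0 < 1 - β := by linarith
      positivity
    have h2 := h1.tendsto.mono_left (nhdsWithin_le_nhds (s := Iio 1))
    have h3 : (1 - β) * c ≠ 0 := mul_ne_zero (by linarith) hc.ne'
    simpa [Real.zero_rpow h3] using h2
  have hmin : 0 < min (min γ (α / 2)) ρ := by positivity
  obtain ⟨r, ⟨hr0, hr1⟩, hVr, hδr⟩ := (Eventually.and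
    (Ioo_mem_nhdsLT (show (0 : ℝ) < 1 by norm_num) : ∀ᶠ r : ℝ in 𝓝[<] 1, r ∈ Ioo 0 1)
    (hV.and (hδlim.eventually_lt_const hmin))).exists
  set δ := B * V * (1 - r) ^ ((1 - β) * c) with hδ
  have hδγ : δ < γ := hδr.trans_le ((min_le_left _ _).trans (min_le_left _ _))
  have hδα : δ < α / 2 := hδr.trans_le ((min_le_left _ _).trans (min_le_right _ _))
  have hδρ : δ < ρ := hδr.trans_le (min_le_right _ _)
  have he0 : 0 < 1 - r := by linarith
  have hδ0 : 0 ≤ δ := by positivity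
  have hmem : ∀ z : ℂ, ‖z‖ < 1 / r → (r : ℂ) * z ∈ disc := by
    intro z hz
    rw [lt_div_iff₀ hr0] at hz
    simpa [disc, abs_of_pos hr0, mul_comm] using hz
  have h1r : 1 < 1 / r := by rw [lt_div_iff₀ hr0]; linarith
  -- Halving `α` makes the inequality strict on `Q`, so the neighbourhood is open and contains `Q`.
  obtain ⟨p, hpd, hp1, hp0, hpl⟩ := hpeak
    {ζ : Circle | α / 2 * (1 - r) ^ β < infDist (f ((r : ℂ) * (ζ : ℂ))) (frontier D)}
    (isOpen_lt continuous_const ((continuous_infDist_pt _).comp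
      (hf.1.continuousOn.comp_continuous (by fun_prop) fun ζ => hmem _ (by rwa [Circle.norm_coe]))))
    (fun ζ hζ => by
      refine lt_of_lt_of_le ?_ (hζ r ⟨hr0, hr1⟩)
      gcongr
      linarith)
  -- Chosen so that `exp L = (1 - r) ^ (β - 1)`: where `g` is largest, the factor `1 - r` becomes
  -- exactly `(1 - r) ^ β`.
  set L : ℝ := -((1 - β) * Real.log (1 - r)) with hL
  have hL0 : 0 ≤ L := by
    have : Real.log (1 - r) ≤ 0 := Real.log_nonpos he0.le (by linarith)
    nlinarith
  set g : ℂ → ℂ := fun z => Complex.exp (L * p z) with hg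
  have hgn : ∀ z, ‖g z‖ = Real.exp (L * (p z).re) := fun z => by
    simp [hg, Complex.norm_exp]
  have hg0 : ∀ z, g z ≠ 0 := fun z => Complex.exp_ne_zero _
  have hgd : Differentiable ℂ g := by fun_prop
  have hgl : ∀ j, ‖g (l j)‖⁻¹ ≤ (1 - r) ^ ((1 - β) * c) := by
    intro j
    rw [hgn, ← Real.exp_neg, Real.rpow_def_of_pos he0]
    have := mul_le_mul_of_nonneg_left (hpl j) hL0
    gcongr
    rw [hL] at this ⊢
    linarith
  set corr : ℂ → Cn n := fun z =>
    g z • ∑ j, (q j z / g (l j)) • (f (l j) - f (r * l j)) with hcorr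
  have hcorrd : Differentiable ℂ corr := by
    refine hgd.smul (Differentiable.fun_sum fun j _ => ?_)
    exact ((hqd j).div_const _).smul_const _
  have hcorrn : ∀ z : ℂ, ‖z‖ ≤ 1 → ‖corr z‖ ≤ δ * (1 - r) * ‖g z‖ := by
    intro z hz
    have h1 : ‖∑ j, (q j z / g (l j)) • (f (l j) - f (r * l j))‖ ≤
        ∑ j, ‖q j z‖ * ((1 - r) ^ ((1 - β) * c) * (V * (1 - r))) := by
      refine norm_sum_le_of_le _ fun j _ => ?_
      rw [norm_smul, norm_div, div_eq_mul_inv, mul_assoc]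
      gcongr
      · exact hgl j
      · exact hVr j
    rw [← Finset.sum_mul] at h1
    rw [hcorr, norm_smul, mul_comm]
    gcongr
    refine h1.trans ((mul_le_mul_of_nonneg_right (hB z hz) (by positivity)).trans_eq ?_)
    rw [hδ]; ring
  have hbig : ∀ z : ℂ, ‖z‖ ≤ 1 → ‖corr z‖ ≤ δ * (1 - r) ^ β := by
    intro z hz
    refine (hcorrn z hz).trans ?_
    rw [mul_assoc]
    gcongr
    have h1 : (p z).re ≤ 1 := re_le_of_sphere hpd.diffContOnCl
      (fun w hw => hp1 ⟨w, by simpa [Submonoid.unitSphere] using hw⟩) hz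
    calc (1 - r) * ‖g z‖ ≤ (1 - r) * Real.exp (L * 1) := by rw [hgn]; gcongr
      _ = (1 - r) ^ β := by
        rw [Real.rpow_def_of_pos he0]
        conv_lhs => rw [← Real.exp_log he0]
        rw [← Real.exp_add, hL]
        congr 1; ring
  set h : ℂ → Cn n := fun z => f (r * z) + corr z with hh
  have hhd : DifferentiableOn ℂ h (ball 0 (1 / r)) := by
    refine DifferentiableOn.add (hf.1.comp (by fun_prop) fun z hz => ?_) hcorrd.differentiableOn
    exact hmem z (by simpa using hz)
  have hsub : closedBall (0 : ℂ) 1 ⊆ ball 0 (1 / r) := closedBall_subset_ball h1r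
  have hfD : ∀ z : ℂ, ‖z‖ ≤ 1 → f (r * z) ∈ D := fun z hz => hf.2 (hmem z (hz.trans_lt h1r))
  have hhD := hR h _ isOpen_ball hsub hhd ?_ ?_
  · refine ⟨h, ⟨ball 0 (1 / r) ∩ h ⁻¹' D, hhd.continuousOn.isOpen_inter_preimage isOpen_ball hDo,
      fun z hz => ⟨hsub hz, hhD z hz⟩, hhd.mono inter_subset_left, fun z hz => hz.2⟩, fun i => ?_⟩
    simp [hh, hcorr, hq, ite_div, ite_smul, smul_smul, hg0]
  · intro z hz
    have hz : ‖z‖ ≤ 1 := by simpa using hz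
    refine ⟨f (r * z), hfD z hz, ?_⟩
    rw [hh, add_sub_cancel_left]
    refine (hbig z hz).trans (le_trans ?_ hδρ.le)
    exact mul_le_of_le_one_right hδ0 (Real.rpow_le_one he0.le (by linarith) hβ0.le)
  · intro z hz
    have hz1 : ‖z‖ = 1 := by simpa using hz
    refine mem_of_norm_sub_lt_infDist_frontier (hfD z hz1.le) ?_
    rw [hh, add_sub_cancel_left]
    set ζ : Circle := ⟨z, by simpa [Submonoid.unitSphere] using hz1⟩ with hζ
    -- Over the neighbourhood of `Q` the room is `α / 2 * (1 - r) ^ β`; elsewhere `‖g‖ ≤ 1` and the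
    -- linear growth condition suffices.
    by_cases hU : α / 2 * (1 - r) ^ β < infDist (f ((r : ℂ) * (ζ : ℂ))) (frontier D)
    · refine lt_of_le_of_lt ((hbig z hz1.le).trans ?_) hU
      gcongr
    · have h1 : (p z).re ≤ 0 := hp0 ζ hU
      have h2 : ‖g z‖ ≤ 1 := by
        rw [hgn, Real.exp_le_one_iff]
        exact mul_nonpos_of_nonneg_of_nonpos hL0 h1
      have h3 := hγf (r * z) (hmem z (hz1.trans_lt h1r))
      have h4 : ‖(r : ℂ) * z‖ = r := by simp [hz1, abs_of_pos hr0]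
      rw [h4] at h3
      refine lt_of_lt_of_le ?_ h3
      calc ‖corr z‖ ≤ δ * (1 - r) * ‖g z‖ := hcorrn z hz1.le
        _ ≤ δ * (1 - r) * 1 := by gcongr
        _ < γ * (1 - r) := by rw [mul_one]; gcongr

/-- Under the radial growth condition the set `Q D f α β` is a null set. -/
theorem arcLength_Q_eq_zero {n m : ℕ} {D : Set (Cn n)} {f : ℂ → Cn n} (hDo : IsOpen D)
    (hf : IsWeakExtremal m D f) {γ α β ρ : ℝ} (hγ : 0 < γ)
    (hγf : ∀ z ∈ disc, γ * (1 - ‖z‖) ≤ infDist (f z) (frontier D))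
    (hα : 0 < α) (hβ : β < 1) (hρ : 0 < ρ)
    (hR : ∀ (h : ℂ → Cn n) (V : Set ℂ), IsOpen V → closedBall 0 1 ⊆ V → DifferentiableOn ℂ h V →
      (∀ z ∈ closedBall (0 : ℂ) 1, ∃ x ∈ D, ‖h z - x‖ ≤ ρ) → (∀ z ∈ sphere (0 : ℂ) 1, h z ∈ D) →
      ∀ z ∈ closedBall (0 : ℂ) 1, h z ∈ D) :
    arcLength (Q D f α β) = 0 := by
  obtain ⟨l, hlinj, hl, hfD, hext⟩ := hf
  -- Raising the exponent enlarges `Q`, so it may be assumed positive.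
  refine measure_mono_null (Q_subset_Q hα.le (le_max_left β (1 / 2))) ?_
  by_contra hQ
  exact hext (exists_holClosedDisc hDo hfD hlinj hl hγ hγf hα
    (lt_of_lt_of_le (by norm_num) (le_max_right _ _)) (max_lt hβ (by norm_num)) hρ hR hQ)

/-! ### From null sets to almost properness -/

/-- Bounded holomorphic maps into `ℂⁿ` have radial limits almost everywhere. -/
lemma ae_exists_hasBoundaryValue {n : ℕ} {D : Set (Cn n)} {f : ℂ → Cn n} (hf : HolDisc f D)
    (hD : Bornology.IsBounded D) : ∀ᵐ ζ ∂arcLength, ∃ w, HasBoundaryValue f ζ w := by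
  obtain ⟨C, hC⟩ := hD.exists_norm_le
  have h1 : ∀ i : Fin n, ∀ᵐ ζ : Circle ∂arcLength,
      ∃ w, Tendsto (fun r : ℝ => f ((r : ℂ) * (ζ : ℂ)) i) (𝓝[<] 1) (𝓝 w) := by
    intro i
    refine ae_exists_radial_limit (f := fun z => f z i) (C := C) ?_ fun z hz => ?_
    · exact (EuclideanSpace.proj (𝕜 := ℂ) i).differentiable.comp_differentiableOn hf.1
    · exact (PiLp.norm_apply_le (f z) i).trans (hC _ (hf.2 hz))
  filter_upwards [ae_all_iff.2 h1] with ζ hζ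
  choose w hw using hζ
  refine ⟨WithLp.toLp 2 w, ?_⟩
  have := ((PiLp.continuous_toLp 2 (fun _ : Fin n => ℂ)).tendsto w).comp (tendsto_pi_nhds.2 hw)
  exact this

/-- If the radial limit lies in `D`, the distance to `∂D` is bounded below near the end of the
radius by continuity and on the rest by compactness. So `ζ` lies in one of the countably many null
sets `Q D f (1 / (k + 1)) 0`. -/
lemma almostProper_of_arcLength_Q {n : ℕ} {D : Set (Cn n)} {f : ℂ → Cn n} (hDo : IsOpen D)
    (hD : Bornology.IsBounded D) (hf : HolDisc f D) (hfr : (frontier D).Nonempty)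
    (hQ : ∀ α > 0, arcLength (Q D f α 0) = 0) : AlmostProper D f := by
  have h1 : ∀ᵐ ζ ∂arcLength, ∀ k : ℕ, ζ ∉ Q D f (1 / ((k : ℝ) + 1)) 0 :=
    ae_all_iff.2 fun k => measure_eq_zero_iff_ae_notMem.1 (hQ _ (by positivity))
  have hpos : ∀ x ∈ D, 0 < infDist x (frontier D) := fun x hx =>
    (isClosed_frontier.notMem_iff_infDist_pos hfr).1 fun h => (hDo.frontier_eq ▸ h).2 hx
  filter_upwards [h1, ae_exists_hasBoundaryValue hf hD] with ζ hζ ⟨w, hw⟩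
  refine ⟨w, ?_, hw⟩
  have hmem : ∀ t ∈ Ico (0 : ℝ) 1, f ((t : ℂ) * (ζ : ℂ)) ∈ D := fun t ht =>
    hf.2 (by simp [disc, Circle.norm_coe, abs_of_nonneg ht.1, ht.2])
  rw [hDo.frontier_eq]
  refine ⟨mem_closure_of_tendsto hw ?_, fun hwD => ?_⟩
  · filter_upwards [Ioo_mem_nhdsLT (show (0 : ℝ) < 1 by norm_num)] with t ht
    exact hmem t ⟨ht.1.le, ht.2⟩
  · have hd := hpos w hwD
    have hlim := ((continuous_infDist_pt (frontier D)).tendsto w).comp hw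
    have hev := hlim.eventually_const_le (half_lt_self hd)
    obtain ⟨a, ha, haI⟩ := (mem_nhdsLT_iff_exists_Ioo_subset' (show (0 : ℝ) < 1 by norm_num)).1 hev
    have ha1 : a < 1 := ha
    obtain ⟨t₀, ht₀, hmin⟩ := (isCompact_Icc (a := 0) (b := max a 0)).exists_isMinOn
      (nonempty_Icc.2 (le_max_right _ _))
      (f := fun t : ℝ => infDist (f ((t : ℂ) * (ζ : ℂ))) (frontier D))
      ((continuous_infDist_pt _).comp_continuousOn (hf.1.continuousOn.comp (by fun_prop)
        fun t ht => by
          have : t < 1 := ht.2.trans_lt (max_lt ha1 one_pos)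
          simp [disc, Circle.norm_coe, abs_of_nonneg ht.1, this]))
    have hm := hpos _ (hmem t₀ ⟨ht₀.1, ht₀.2.trans_lt (max_lt ha1 one_pos)⟩)
    obtain ⟨k, hk⟩ := exists_nat_one_div_lt (lt_min (half_pos hd) hm)
    refine hζ k fun t ht => ?_
    rw [Real.rpow_zero, mul_one]
    refine hk.le.trans ?_
    by_cases hta : a < t
    · exact (min_le_left _ _).trans (haI ⟨hta, ht.2⟩)
    · exact (min_le_right _ _).trans (hmin ⟨ht.1.le, (not_lt.1 hta).trans (le_max_left _ _)⟩)

/-! ### Weakly Runge and convex domains -/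

/-- Since `closure D` is compact, `G` contains a closed `ρ`-neighbourhood of it, so maps staying
`ρ`-close to `D` are admissible in the weak Runge property. -/
lemma WeaklyRunge.exists_pos_maps_closedBall {n : ℕ} {D : Set (Cn n)} (hD : WeaklyRunge D) :
    ∃ ρ > 0, ∀ (h : ℂ → Cn n) (V : Set ℂ), IsOpen V → closedBall 0 1 ⊆ V → DifferentiableOn ℂ h V →
      (∀ z ∈ closedBall (0 : ℂ) 1, ∃ x ∈ D, ‖h z - x‖ ≤ ρ) → (∀ z ∈ sphere (0 : ℂ) 1, h z ∈ D) →
      ∀ z ∈ closedBall (0 : ℂ) 1, h z ∈ D := by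
  obtain ⟨-, hbdd, G, hG, hDG, hrunge⟩ := hD
  obtain ⟨ρ, hρ, hthick⟩ := hbdd.isCompact_closure.exists_cthickening_subset_open hG.1 hDG
  refine ⟨ρ, hρ, fun h V hV hsub hh hnear hbd z hz => ?_⟩
  have hcont : ContinuousOn h (closedBall 0 1) := hh.continuousOn.mono hsub
  have himage := hrunge h ⟨hh.mono (ball_subset_closedBall.trans hsub), ?_⟩ ?_ ?_
  · obtain ⟨K, hK, hKD, hmaps⟩ := himage
    have := MapsTo.closure_of_continuousOn (s := disc) hmaps
      (by rwa [disc, closure_ball _ one_ne_zero])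
    rw [disc, closure_ball _ one_ne_zero, hK.isClosed.closure_eq] at this
    exact hKD (this hz)
  · intro w hw
    obtain ⟨x, hx, hwx⟩ := hnear w (ball_subset_closedBall hw)
    exact hthick (mem_cthickening_of_dist_le _ x _ _ (subset_closure hx) (by rwa [dist_eq_norm]))
  · exact ((isCompact_closedBall (0 : ℂ) 1).image_of_continuousOn hcont).isBounded.subset
      (image_mono ball_subset_closedBall)
  · refine ⟨h '' sphere 0 1, (isCompact_sphere _ _).image_of_continuousOn
      (hcont.mono sphere_subset_closedBall), image_subset_iff.2 hbd, Eventually.of_forall fun ζ => ?_⟩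
    refine ⟨h ζ, mem_image_of_mem h (by simp [Circle.norm_coe]), ?_⟩
    have h1 : ContinuousAt h (ζ : ℂ) :=
      (hh.differentiableAt (hV.mem_nhds (hsub (by simp [Circle.norm_coe])))).continuousAt
    have h2 : Tendsto (fun r : ℝ => (r : ℂ) * (ζ : ℂ)) (𝓝[<] 1) (𝓝 (ζ : ℂ)) := by
      have : Continuous fun r : ℝ => (r : ℂ) * (ζ : ℂ) := by fun_prop
      simpa using (this.tendsto 1).mono_left (nhdsWithin_le_nhds (s := Iio 1))
    exact h1.tendsto.comp h2

/-- A value outside `D` would be separated from `D` by a complex functional, against the maximum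
principle for its real part; compactness of the circle keeps the inequality strict. -/
lemma maps_closedBall_of_convex {n : ℕ} {D : Set (Cn n)} (hDo : IsOpen D) (hc : Convex ℝ D)
    {h : ℂ → Cn n} (hh : DiffContOnCl ℂ h (ball 0 1)) (hbd : ∀ z ∈ sphere (0 : ℂ) 1, h z ∈ D) :
    ∀ z ∈ closedBall (0 : ℂ) 1, h z ∈ D := by
  intro z hz
  by_contra hzD
  obtain ⟨φ, hφ⟩ := RCLike.geometric_hahn_banach_open_point (𝕜 := ℂ) hc hDo hzD
  have hφh : DiffContOnCl ℂ (fun z => φ (h z)) (ball 0 1) := φ.differentiable.comp_diffContOnCl hh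
  have hcont : ContinuousOn (fun z => (φ (h z)).re) (sphere (0 : ℂ) 1) :=
    Complex.continuous_re.comp_continuousOn (hφh.continuousOn_ball.mono sphere_subset_closedBall)
  obtain ⟨w, hw, hmax⟩ := (isCompact_sphere (0 : ℂ) 1).exists_isMaxOn
    (NormedSpace.sphere_nonempty.2 zero_le_one) hcont
  have := re_le_of_sphere hφh (fun v hv => hmax (show v ∈ sphere (0 : ℂ) 1 by simpa using hv))
    (z := z) (by simpa using hz)
  exact absurd this (not_le.2 (hφ _ (hbd w hw)))

/-- Hopf's lemma for discs in a convex domain. -/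
lemma infDist_frontier_ge_of_convex {n : ℕ} {D : Set (Cn n)} {f : ℂ → Cn n} (hDo : IsOpen D)
    (hc : Convex ℝ D) (hfr : (frontier D).Nonempty) (hf : HolDisc f D) {z : ℂ} (hz : z ∈ disc) :
    infDist (f 0) (frontier D) / 2 * (1 - ‖z‖) ≤ infDist (f z) (frontier D) := by
  refine (le_infDist hfr).2 fun w hw => ?_
  have hz1 : 0 < 1 - ‖z‖ := by simpa [disc] using hz
  have hwD : w ∉ D := (hDo.frontier_eq ▸ hw).2
  obtain ⟨φ, hφ⟩ := RCLike.geometric_hahn_banach_open_point (𝕜 := ℂ) hc hDo hwD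
  by_contra! hlt
  rw [dist_comm, dist_eq_norm] at hlt
  have hk := harnack_re (k := fun z => φ w - φ (f z)) (z := z)
    ((φ.differentiable.comp_differentiableOn hf.1).const_sub _)
    (fun v hv => by simpa using hφ _ (hf.2 hv)) hz
  -- The inverse of the Harnack constant: moving from `f 0` by `s • (w - f z)` stays in `D` if `w`
  -- is too close to `f z`, yet by Harnack crosses the supporting hyperplane at `w`.
  set s : ℝ := 2 / (1 - ‖z‖) with hs
  have hs0 : 0 < s := by positivity
  have hmem : f 0 + s • (w - f z) ∈ D := by
    refine mem_of_norm_sub_lt_infDist_frontier (hf.2 (show (0 : ℂ) ∈ disc by simp [disc])) ?_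
    rw [add_sub_cancel_left, norm_smul, Real.norm_of_nonneg hs0.le, hs, div_mul_eq_mul_div,
      div_lt_iff₀ hz1]
    linarith
  have h1 := hφ _ hmem
  have h2 : φ (s • (w - f z)) = s • (φ w - φ (f z)) := by
    rw [← map_sub]
    exact (φ.restrictScalars ℝ).map_smul s _
  rw [map_add, h2] at h1
  simp only [map_add, RCLike.re_to_complex, Complex.smul_re, smul_eq_mul, Complex.sub_re] at h1 hk
  have h3 := mul_le_mul_of_nonneg_left hk hs0.le
  rw [← mul_assoc, show s * ((1 - ‖z‖) / 2) = 1 by rw [hs]; field_simp, one_mul] at h3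
  linarith

/-- Needed because `infDist` to the empty set is 0. The only bounded domain without frontier is the
point `ℂ⁰`, where `f` is its own competitor. -/
lemma IsWeakExtremal.frontier_nonempty {n m : ℕ} {D : Set (Cn n)} {f : ℂ → Cn n}
    (hD : IsDomainCn D) (hb : Bornology.IsBounded D) (hf : IsWeakExtremal m D f) :
    (frontier D).Nonempty := by
  rw [nonempty_iff_ne_empty]
  intro hfr
  have huniv : D = univ := (isClopen_iff_frontier_eq_empty.2 hfr).eq_univ hD.2.nonempty
  subst huniv
  rcases subsingleton_or_nontrivial (Cn n) with hs | hn
  · obtain ⟨l, -, -, -, hext⟩ := hf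
    exact hext ⟨f, ⟨univ, isOpen_univ, subset_univ _,
      fun z _ => ((hasDerivAt_const z (f z)).congr_of_eventuallyEq
        (Eventually.of_forall fun _ => Subsingleton.elim _ _)).differentiableAt.differentiableWithinAt, mapsTo_univ _ _⟩, fun _ => rfl⟩
  · exact NormedSpace.unbounded_univ ℂ (Cn n) hb

end WeakExtremal

theorem mainTheorem11 (n m : ℕ) (hm : 2 ≤ m) :
    (∀ (D : Set (WeakExtremal.Cn n)) (f : ℂ → WeakExtremal.Cn n),
      WeakExtremal.WeaklyRunge D →
      WeakExtremal.IsWeakExtremal m D f →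
      (∃ γ : ℝ, 0 < γ ∧ ∀ z ∈ WeakExtremal.disc,
        γ * (1 - ‖z‖) ≤ Metric.infDist (f z) (frontier D)) →
      (∀ α β : ℝ, 0 < α → β < 1 →
        WeakExtremal.arcLength (WeakExtremal.Q D f α β) = 0) ∧
      WeakExtremal.AlmostProper D f) ∧
    (∀ (D : Set (WeakExtremal.Cn n)) (f : ℂ → WeakExtremal.Cn n),
      WeakExtremal.IsDomainCn D → Bornology.IsBounded D → Convex ℝ D →
      WeakExtremal.IsWeakExtremal m D f →
      WeakExtremal.AlmostProper D f) := by
  constructor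
  · rintro D f hD hf ⟨γ, hγ, hγf⟩
    obtain ⟨ρ, hρ, hR⟩ := hD.exists_pos_maps_closedBall
    have hQ : ∀ α β : ℝ, 0 < α → β < 1 → WeakExtremal.arcLength (WeakExtremal.Q D f α β) = 0 :=
      fun α β hα hβ => WeakExtremal.arcLength_Q_eq_zero hD.1.1 hf hγ hγf hα hβ hρ hR
    have hfr := hf.frontier_nonempty hD.1 hD.2.1
    obtain ⟨l, -, -, hfD, -⟩ := hf
    exact ⟨hQ, WeakExtremal.almostProper_of_arcLength_Q hD.1.1 hD.2.1 hfD hfr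
      fun α hα => hQ α 0 hα one_pos⟩
  · intro D f hD hb hc hf
    have hfr := hf.frontier_nonempty hD hb
    obtain ⟨l, -, -, hfD, -⟩ := id hf
    have h0D : f 0 ∈ D := hfD.2 (by simp [WeakExtremal.disc])
    have hd : 0 < infDist (f 0) (frontier D) :=
      (isClosed_frontier.notMem_iff_infDist_pos hfr).1 fun h => (hD.1.frontier_eq ▸ h).2 h0D
    refine WeakExtremal.almostProper_of_arcLength_Q hD.1 hb hfD hfr fun α hα => ?_
    -- Hopf's lemma provides `γ = infDist (f 0) (frontier D) / 2`.
    refine WeakExtremal.arcLength_Q_eq_zero hD.1 hf (half_pos hd)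
      (fun z hz => WeakExtremal.infDist_frontier_ge_of_convex hD.1 hc hfr hfD hz) hα one_pos
      one_pos fun h V _ hsub hh _ hbd => ?_
    refine WeakExtremal.maps_closedBall_of_convex hD.1 hc ?_ hbd
    exact (hh.mono ((closure_ball (0 : ℂ) one_ne_zero).le.trans hsub)).diffContOnCl
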